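/- **Theorem (Soundness of the Transformation).** *Terms.* Let $(\Sigma,\Delta)$ be a signature of finitely many function and predicate symbols with fixed arities, where $\Sigma$ contains a constant, and let $\mathcal V$ be an infinite set of variables. $\mathcal T^\infty(\Sigma,\mathcal V)$ is the set of all possibly infinite terms (trees) over $\Sigma$ and $\mathcal V$. A term is *finite* if all its paths are finite, *rational* if it has only finitely many different subterms, and *ground* if it contains no variables. $\mathcal T(\Sigma,\mathcal V)$ denotes the set of finite terms. An atom $p(t_1,\dots,t_n)$ with $p/n\in\Delta$ is finite, rational or ground if all the $t_i$ are. Substitutions are arbitrary maps $\mathcal V\to\mathcal T^\infty(\Sigma,\mathcal V)$. *Logic programs.* A program $\mathcal P$ is a finite set of clauses $H \mathrel{:\!-} B_1,\dots,B_k$ ($k\ge 0$) whose atoms are finite. A query is a finite sequence of atoms. A query $A_1,\dots,A_m$ ($m\geq 1$) has the resolvent $(B_1,\dots,B_k,A_2,\dots,A_m)\theta$ with a clause $H \mathrel{:\!-} B_1,\dots,B_k$ if $\theta$ is a most general unifier of $A_1$ and $H$. Here there is no occur check, i.e., $A_1\theta=H\theta$, and for every substitution $\sigma$ with $A_1\sigma=H\sigma$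 there is a substitution $\mu$ with $\sigma=\theta\mu$. A derivation of $\mathcal P$ and $Q$ is a finite or infinite sequence $Q=Q_0,Q_1,\dots$ of queries in which $Q_{i+1}$ is a resolvent of $Q_i$ with a fresh variant $c_{i+1}$ of a clause of $\mathcal P$, i.e., with a clause that results from a clause of $\mathcal P$ by a bijective renaming of variables and that has no variable in common with $Q_0,\dots,Q_i$ and $c_1,\dots,c_i$. The query $Q$ *terminates* for $\mathcal P$ if all derivations of $\mathcal P$ and $Q$ are finite. *Infinitary constructor rewriting.* A term rewrite system (TRS) $\mathcal R$ over a set $\Sigma'$ of function symbols is a finite set of rules $\ell\to r$ with $\ell,r\in\mathcal T(\Sigma',\mathcal V)$, $\ell\notin\mathcal V$ (variables of $r$ need not occur in $\ell$). Its defined symbols are the roots of the left-hand sides $\ell$; all other symbols of $\Sigma'$ are constructors, and $\Sigma'_C$ is the set of constructors. For $s,t\in\mathcal T^\infty(\Sigma',\mathcal V)$, we have $s\to_{\mathcal R}t$ if there are a rule $\ell\to r$ of $\mathcal R$, a substitution $\sigma:\mathcal V\to\mathcal T^\infty(\Sigma'_C,\mathcal V)$, and a position of $s$ at which the subterm of $s$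 is $\ell\sigma$, and $t$ results from $s$ by replacing the subterm at this position by $r\sigma$. A term $t$ is *terminating* for $\mathcal R$ if there is no infinite sequence $t\to_{\mathcal R}t_1\to_{\mathcal R}t_2\to_{\mathcal R}\cdots$. *Transformation.* For a program $\mathcal P$ over $(\Sigma,\Delta)$, the TRS $\mathcal R_{\mathcal P}$ over $\Sigma_{\mathcal P}=\Sigma\cup\{p_{in}/n,\,p_{out}/n\mid p/n\in\Delta\}\cup\{u_{c,i}\mid c\in\mathcal P,\ 1\le i\le k,\ k \text{ the number of body atoms of } c\}$ consists of the following rules. For each fact $p(\vec s)$ of $\mathcal P$ (a clause with empty body), it contains $p_{in}(\vec s)\to p_{out}(\vec s)$. For each clause $c$ of the form $p(\vec s)\mathrel{:\!-}p_1(\vec s_1),\dots,p_k(\vec s_k)$ in $\mathcal P$ with $k\ge1$, it contains $$p_{in}(\vec s)\to u_{c,1}(p_{1_{in}}(\vec s_1),\vec X_1),$$ $$u_{c,i}(p_{i_{out}}(\vec s_i),\vec X_i)\to u_{c,i+1}(p_{{i+1}_{in}}(\vec s_{i+1}),\vec X_{i+1})\quad(1\le i<k),$$ $$u_{c,k}(p_{k_{out}}(\vec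 s_k),\vec X_k)\to p_{out}(\vec s),$$ where $\vec X_i$ lists without repetition the variables that occur in $\vec s,\vec s_1,\dots,\vec s_{i-1}$. *Argument filters.* An argument filter $\pi$ over $(\Sigma,\Delta)$ maps every symbol $f/n\in\Sigma\cup\Delta$ to a set $\pi(f)\subseteq\{1,\dots,n\}$. It is extended to possibly infinite terms and to atoms by $\pi(X)=X$ for variables $X$ and $\pi(f(t_1,\dots,t_n))=f(\pi(t_{i_1}),\dots,\pi(t_{i_k}))$ if $\pi(f)=\{i_1,\dots,i_k\}$ with $i_1<\dots<i_k$. *Claim.* Let $\mathcal P$ be a logic program and let $\pi$ be an argument filter over $(\Sigma,\Delta)$, extended by $\pi(p_{in})=\pi(p)$ for all $p\in\Delta$. Let $$S=\{\,p_{in}(t_1,\dots,t_n)\mid p/n\in\Delta,\ t_1,\dots,t_n\in\mathcal T^\infty(\Sigma,\mathcal V),\ \pi(p_{in}(t_1,\dots,t_n))\text{ is a finite ground term}\,\}.$$ If all terms $s\in S$ are terminating for $\mathcal R_{\mathcal P}$, then every query that consists of a single rational atom $Q$ over $(\Sigma,\Delta)$ for which $\pi(Q)$ is a finite ground atom terminates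 for $\mathcal P$. -/

import Mathlib

/-!
Definite logic programs over finite and infinite terms, left-to-right SLD resolution without occur
check, infinitary constructor rewriting, and the transformation of programs into rewrite systems.
-/

universe u v w x

namespace LP

/-! ### Terms -/

/-- A set of symbols, each of which has an arity. A signature `(Σ, Δ)` is a pair of alphabets:
one of function symbols and one of predicate symbols. -/
structure Alphabet where
  Sym : Type u
  arity : Sym → ℕ

/-- Finite terms over the function symbols `F` with variables from `V`. -/
inductive FTerm (F : Alphabet.{u}) (V : Type v) : Type (max u v)
  | var (X : V) : FTerm F V
  | app (f : F.Sym) (ts : Fin (F.arity f) → FTerm F V) : FTerm F V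

/-- The polynomial functor whose final coalgebra is the set of possibly infinite terms. -/
def shape (F : Alphabet.{u}) (V : Type v) : PFunctor.{max u v, 0} where
  A := V ⊕ F.Sym
  B := Sum.elim (fun _ => Fin 0) (fun f => Fin (F.arity f))

/-- Possibly infinite terms: trees whose nodes carry a variable (without children) or a
function symbol `f` (with as many children as the arity of `f`). -/
def Term (F : Alphabet.{u}) (V : Type v) : Type (max u v) := (shape F V).M

/-- The root of a term, with children in `T`. -/
inductive Layer (F : Alphabet.{u}) (V : Type v) (T : Type w) : Type (max u v w)
  | var (X : V) : Layer F V T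
  | app (f : F.Sym) (ts : Fin (F.arity f) → T) : Layer F V T

namespace Layer

variable {F : Alphabet.{u}} {V : Type v} {T : Type w} {T' : Type x}

def map (g : T → T') : Layer F V T → Layer F V T'
  | .var X => .var X
  | .app f ts => .app f (fun i => g (ts i))

def toObj : Layer F V T → (shape F V).Obj T
  | .var X => ⟨Sum.inl X, fun i => Fin.elim0 i⟩
  | .app f ts => ⟨Sum.inr f, ts⟩

def ofObj : (shape F V).Obj T → Layer F V T
  | ⟨Sum.inl X, _⟩ => .var X
  | ⟨Sum.inr f, ts⟩ => .app f ts

theorem ofObj_toObj (l : Layer F V T) : ofObj l.toObj = l := by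
  cases l <;> rfl

theorem toObj_ofObj (o : (shape F V).Obj T) : (ofObj o).toObj = o := by
  obtain ⟨a, ts⟩ := o
  cases a with
  | inl X =>
    simp only [ofObj, toObj]
    congr 1
    funext i
    exact Fin.elim0 i
  | inr f => rfl

theorem map_toObj (g : T → T') (l : Layer F V T) :
    (shape F V).map g l.toObj = (l.map g).toObj := by
  cases l with
  | var X =>
    exact Sigma.ext rfl (heq_of_eq (funext fun i => Fin.elim0 i))
  | app f ts => rfl

end Layer

namespace Term

variable {F : Alphabet.{u}} {V : Type v}

/-- The tree with root `l`. -/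
def mk (l : Layer F V (Term F V)) : Term F V := PFunctor.M.mk l.toObj

/-- The root of a tree and its direct subtrees. -/
def out (t : Term F V) : Layer F V (Term F V) := Layer.ofObj (PFunctor.M.dest t)

/-- The tree that is generated from a seed. -/
def unfold {T : Type w} (g : T → Layer F V T) (s : T) : Term F V :=
  PFunctor.M.corec (fun s => (g s).toObj) s

theorem mk_out (t : Term F V) : mk t.out = t := by
  have h : (Layer.ofObj (PFunctor.M.dest t)).toObj = PFunctor.M.dest t := Layer.toObj_ofObj _
  exact (congrArg PFunctor.M.mk h).trans (PFunctor.M.mk_dest t)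

theorem out_mk (l : Layer F V (Term F V)) : (mk l).out = l := by
  have h : PFunctor.M.dest (PFunctor.M.mk l.toObj) = l.toObj := PFunctor.M.dest_mk _
  exact (congrArg Layer.ofObj h).trans (Layer.ofObj_toObj l)

theorem out_unfold {T : Type w} (g : T → Layer F V T) (s : T) :
    (unfold g s).out = (g s).map (unfold g) := by
  have h : PFunctor.M.dest (PFunctor.M.corec (fun s => (g s).toObj) s) =
      ((g s).map (unfold g)).toObj :=
    (PFunctor.M.dest_corec _ s).trans (Layer.map_toObj (unfold g) (g s))
  exact (congrArg Layer.ofObj h).trans (Layer.ofObj_toObj _)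

/-- The term that consists of a variable. -/
def var (X : V) : Term F V := mk (.var X)

/-- The term `f(t₁, …, tₙ)`. -/
def app (f : F.Sym) (ts : Fin (F.arity f) → Term F V) : Term F V := mk (.app f ts)

/-- `Subterm s t`: the term `s` is a subterm of `t`. -/
inductive Subterm (s : Term F V) : Term F V → Prop
  | refl : Subterm s s
  | arg (f : F.Sym) (ts : Fin (F.arity f) → Term F V) (i : Fin (F.arity f)) :
      Subterm s (ts i) → Subterm s (app f ts)

/-- The variables of a term. -/
def vars (t : Term F V) : Set V := {X | Subterm (var X) t}

/-- The function symbols of a term. -/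
def syms (t : Term F V) : Set F.Sym := {f | ∃ ts, Subterm (app f ts) t}

/-- A term is finite if it has no infinite path, i.e. if its direct-subterm relation is
well founded below it. -/
inductive IsFinite : Term F V → Prop
  | var (X : V) : IsFinite (var X)
  | app (f : F.Sym) (ts : Fin (F.arity f) → Term F V) :
      (∀ i, IsFinite (ts i)) → IsFinite (app f ts)

/-- A term is ground if it has no variables. -/
def IsGround (t : Term F V) : Prop := t.vars = ∅

/-- A term is rational if it has only finitely many different subterms. -/
def IsRational (t : Term F V) : Prop := {s | Subterm s t}.Finite

end Term

/-- Infinite substitutions. -/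
abbrev Subst (F : Alphabet.{u}) (V : Type v) : Type (max u v) := V → Term F V

namespace Term

variable {F : Alphabet.{u}} {V : Type v}

/-- The application of a substitution. A seed `inl t` stands for `tσ`, a seed `inr t` for `t`. -/
def subst (σ : Subst F V) (t : Term F V) : Term F V :=
  unfold (T := Term F V ⊕ Term F V)
    (Sum.elim
      (fun t => match t.out with
        | .var X => (σ X).out.map Sum.inr
        | .app f ts => .app f (fun i => Sum.inl (ts i)))
      (fun t => t.out.map Sum.inr))
    (Sum.inl t)

theorem eq_of_bisim (R : Term F V → Term F V → Prop)
    (h : ∀ s t, R s t → (∃ X, s.out = .var X ∧ t.out = .var X) ∨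
      ∃ f ss ts, s.out = .app f ss ∧ t.out = .app f ts ∧ ∀ i, R (ss i) (ts i))
    (s t : Term F V) (hst : R s t) : s = t := by
  refine PFunctor.M.bisim (P := shape F V) R ?_ s t hst
  intro s t hst
  have key : ∀ t : Term F V, PFunctor.M.dest t = t.out.toObj := fun t =>
    (Layer.toObj_ofObj _).symm
  rcases h s t hst with ⟨X, hs, ht⟩ | ⟨f, ss, ts, hs, ht, hr⟩
  · exact ⟨Sum.inl X, fun i => Fin.elim0 i, fun i => Fin.elim0 i,
      (key s).trans (by rw [hs]; rfl), (key t).trans (by rw [ht]; rfl), fun i => Fin.elim0 i⟩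
  · exact ⟨Sum.inr f, ss, ts, (key s).trans (by rw [hs]; rfl),
      (key t).trans (by rw [ht]; rfl), hr⟩

theorem unfold_copy {T : Type w} (g : T → Layer F V T) (e : Term F V → T)
    (he : ∀ t, g (e t) = t.out.map e) (t : Term F V) : unfold g (e t) = t := by
  refine eq_of_bisim (fun s t => s = unfold g (e t)) ?_ _ _ rfl
  rintro s t rfl
  rw [out_unfold, he]
  cases h : t.out with
  | var X => exact Or.inl ⟨X, rfl, rfl⟩
  | app f ts => exact Or.inr ⟨f, _, ts, rfl, rfl, fun i => rfl⟩

theorem subst_var (σ : Subst F V) (X : V) : (var X).subst σ = σ X := by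
  rw [← mk_out ((var X).subst σ), ← mk_out (σ X)]
  congr 1
  rw [subst, out_unfold]
  simp only [Sum.elim_inl, var, out_mk]
  cases h : (σ X).out with
  | var Y => rfl
  | app f ts =>
    simp only [Layer.map]
    congr 1
    funext i
    exact unfold_copy _ Sum.inr (fun _ => rfl) (ts i)

theorem subst_app (σ : Subst F V) (f : F.Sym) (ts : Fin (F.arity f) → Term F V) :
    (app f ts).subst σ = app f (fun i => (ts i).subst σ) := by
  rw [← mk_out ((app f ts).subst σ), subst, out_unfold]
  simp only [Sum.elim_inl, app, out_mk]
  rfl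

end Term

namespace FTerm

variable {F : Alphabet.{u}} {V : Type v}

/-- Finite terms as possibly infinite terms. -/
def toTerm : FTerm F V → Term F V
  | .var X => Term.var X
  | .app f ts => Term.app f (fun i => (ts i).toTerm)

/-- The occurrences of variables in a finite term, from left to right. -/
def varList : FTerm F V → List V
  | .var X => [X]
  | .app _ ts => (List.ofFn fun i => (ts i).varList).flatten

def rename (ρ : V → V) : FTerm F V → FTerm F V
  | .var X => .var (ρ X)
  | .app f ts => .app f (fun i => (ts i).rename ρ)

end FTerm

/-! ### Logic programs and SLD resolution -/

/-- Atoms over the predicate symbols `D` with arguments from `T`. -/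
structure Atom (D : Alphabet.{u}) (T : Type v) : Type (max u v) where
  pred : D.Sym
  args : Fin (D.arity pred) → T

namespace Atom

def map {D : Alphabet.{u}} {T : Type v} {T' : Type w} (g : T → T') (A : Atom D T) : Atom D T' :=
  ⟨A.pred, fun i => g (A.args i)⟩

variable {F : Alphabet.{u}} {D : Alphabet.{v}} {V : Type w}

def subst (θ : Subst F V) (A : Atom D (Term F V)) : Atom D (Term F V) := A.map (Term.subst θ)

def vars (A : Atom D (Term F V)) : Set V := {X | ∃ i, X ∈ (A.args i).vars}

def varList (A : Atom D (FTerm F V)) : List V :=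
  (List.ofFn fun i => (A.args i).varList).flatten

def toTerm (A : Atom D (FTerm F V)) : Atom D (Term F V) := A.map FTerm.toTerm

def IsRational (A : Atom D (Term F V)) : Prop := ∀ i, (A.args i).IsRational

def IsFinite (A : Atom D (Term F V)) : Prop := ∀ i, (A.args i).IsFinite

def IsGround (A : Atom D (Term F V)) : Prop := A.vars = ∅

end Atom

/-- Definite clauses `H :- B₁, …, Bₖ` with finite atoms. -/
structure Clause (F : Alphabet.{u}) (D : Alphabet.{v}) (V : Type w) : Type (max u v w) where
  head : Atom D (FTerm F V)
  body : List (Atom D (FTerm F V))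

namespace Clause

variable {F : Alphabet.{u}} {D : Alphabet.{v}} {V : Type w}

def vars (c : Clause F D V) : Set V :=
  {X | X ∈ c.head.varList ∨ ∃ B ∈ c.body, X ∈ B.varList}

def rename (ρ : V → V) (c : Clause F D V) : Clause F D V :=
  ⟨c.head.map (FTerm.rename ρ), c.body.map (Atom.map (FTerm.rename ρ))⟩

/-- `c'` is a variant of `c`: it results from `c` by a bijective renaming of the variables. -/
def IsVariant (c' c : Clause F D V) : Prop := ∃ ρ : Equiv.Perm V, c' = c.rename ρ

end Clause

/-- Definite logic programs. -/
abbrev Program (F : Alphabet.{u}) (D : Alphabet.{v}) (V : Type w) : Type (max u v w) :=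
  Finset (Clause F D V)

/-- Queries `A₁, …, Aₘ`. The atoms may contain infinite terms. -/
abbrev Query (F : Alphabet.{u}) (D : Alphabet.{v}) (V : Type w) : Type (max u v w) :=
  List (Atom D (Term F V))

section Resolution

variable {F : Alphabet.{u}} {D : Alphabet.{v}} {V : Type w}

def Query.vars (Q : Query F D V) : Set V := {X | ∃ A ∈ Q, X ∈ A.vars}

def IsUnifier (θ : Subst F V) (A B : Atom D (Term F V)) : Prop := A.subst θ = B.subst θ

/-- Most general unifiers, without occur check: they may contain infinite terms. -/
def IsMGU (θ : Subst F V) (A B : Atom D (Term F V)) : Prop :=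
  IsUnifier θ A B ∧
    ∀ σ : Subst F V, IsUnifier σ A B → ∃ μ : Subst F V, ∀ X, σ X = (θ X).subst μ

/-- `Q'` is a resolvent of `Q` and `c` using `θ`; the leftmost atom of `Q` is selected. -/
def Resolvent (Q : Query F D V) (c : Clause F D V) (θ : Subst F V) (Q' : Query F D V) : Prop :=
  ∃ (A : Atom D (Term F V)) (As : Query F D V), Q = A :: As ∧ IsMGU θ A c.head.toTerm ∧
    Q' = (c.body.map Atom.toTerm ++ As).map (Atom.subst θ)

/-- The queries `Q 0, Q 1, …` form an infinite derivation of `P`: for all `i`, the query `Q (i + 1)`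
is a resolvent of `Q i` and `c i` using `θ i`, where `c i` is a variant of a clause of `P` that is
fresh, i.e. shares no variable with the queries and clauses that came before it. -/
structure IsInfiniteDerivation (P : Program F D V) (Q : ℕ → Query F D V)
    (c : ℕ → Clause F D V) (θ : ℕ → Subst F V) : Prop where
  resolvent : ∀ i, Resolvent (Q i) (c i) (θ i) (Q (i + 1))
  variant : ∀ i, ∃ c₀ ∈ P, (c i).IsVariant c₀
  fresh_query : ∀ i, ∀ j ≤ i, Disjoint (c i).vars (Q j).vars
  fresh_clause : ∀ i, ∀ j < i, Disjoint (c i).vars (c j).vars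

/-- The query `Q₀` terminates for `P`: all its derivations are finite. -/
def Query.Terminates (P : Program F D V) (Q₀ : Query F D V) : Prop :=
  ¬ ∃ Q c θ, Q 0 = Q₀ ∧ IsInfiniteDerivation P Q c θ

end Resolution

/-! ### Infinitary constructor rewriting -/

/-- Rewrite rules `lhs → rhs`. Variables of `rhs` need not occur in `lhs`. -/
structure Rule (G : Alphabet.{u}) (V : Type v) : Type (max u v) where
  lhs : FTerm G V
  rhs : FTerm G V

/-- Term rewrite systems: finite sets of rules whose left-hand sides are not variables. -/
structure TRS (G : Alphabet.{u}) (V : Type v) : Type (max u v) where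
  rules : Set (Rule G V)
  finite : rules.Finite
  lhs_ne_var : ∀ r ∈ rules, ∀ X, r.lhs ≠ FTerm.var X

namespace TRS

variable {G : Alphabet.{u}} {V : Type v}

/-- Defined symbols: the roots of the left-hand sides. -/
def defined (R : TRS G V) : Set G.Sym := {f | ∃ r ∈ R.rules, ∃ ts, r.lhs = FTerm.app f ts}

def constructors (R : TRS G V) : Set G.Sym := R.definedᶜ

/-- The infinitary constructor rewrite relation: at any position, a rule may be applied whose
variables are instantiated by possibly infinite constructor terms. -/
inductive Step (R : TRS G V) : Term G V → Term G V → Prop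
  | root (r : Rule G V) (σ : Subst G V) (hr : r ∈ R.rules)
      (hσ : ∀ X, (σ X).syms ⊆ R.constructors) :
      Step R (r.lhs.toTerm.subst σ) (r.rhs.toTerm.subst σ)
  | arg (f : G.Sym) (ts : Fin (G.arity f) → Term G V) (i : Fin (G.arity f)) (t' : Term G V) :
      Step R (ts i) t' → Step R (Term.app f ts) (Term.app f (Function.update ts i t'))

/-- The term `t` is terminating for `R`. -/
def Terminating (R : TRS G V) (t : Term G V) : Prop :=
  ¬ ∃ s : ℕ → Term G V, s 0 = t ∧ ∀ i, R.Step (s i) (s (i + 1))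

end TRS

/-! ### The transformation of logic programs into rewrite systems -/

section Transformation

variable {F : Alphabet.{u}} {D : Alphabet.{v}} {V : Type w}

open Classical in
/-- The variables of the head and of the first `i` body atoms of `c`, listed without repetition. -/
noncomputable def Clause.varsUpTo (c : Clause F D V) (i : ℕ) : List V :=
  (c.head.varList ++ (c.body.take i).flatMap Atom.varList).dedup

/-- The symbols of the transformed system: the function symbols `f`, the symbols `p_in` and `p_out`
for all predicate symbols `p`, and the symbols `u_{c,i}` for all clauses `c` of `P` and all
body atoms of `c` (where `i` counts from `0`). -/
inductive TransSym (P : Program F D V) : Type (max u v w)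
  | fn (f : F.Sym) : TransSym P
  | pin (p : D.Sym) : TransSym P
  | pout (p : D.Sym) : TransSym P
  | u (c : {c // c ∈ P}) (i : Fin c.1.body.length) : TransSym P

/-- The signature of the transformed system. -/
noncomputable abbrev transAlphabet (P : Program F D V) : Alphabet.{max u v w} where
  Sym := TransSym P
  arity
    | .fn f => F.arity f
    | .pin p => D.arity p
    | .pout p => D.arity p
    | .u c i => (c.1.varsUpTo i).length + 1

variable (P : Program F D V)

/-- Finite terms over the function symbols as terms of the transformed system. -/
noncomputable def FTerm.lift : FTerm F V → FTerm (transAlphabet P) V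
  | .var X => .var X
  | .app f ts => .app (F := transAlphabet P) (TransSym.fn f) (fun i => (ts i).lift)

/-- Possibly infinite terms over the function symbols as terms of the transformed system. -/
noncomputable def Term.lift (t : Term F V) : Term (transAlphabet P) V :=
  Term.unfold
    (fun t : Term F V => match t.out with
      | .var X => Layer.var X
      | .app f ts => Layer.app (F := transAlphabet P) (TransSym.fn f) ts)
    t

theorem Term.lift_var (X : V) : (Term.var X : Term F V).lift P = Term.var X := by
  rw [← Term.mk_out (Term.lift P _), Term.lift, Term.out_unfold]
  simp only [Term.var, Term.out_mk]
  rfl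

theorem Term.lift_app (f : F.Sym) (ts : Fin (F.arity f) → Term F V) :
    (Term.app f ts).lift P =
      Term.app (F := transAlphabet P) (TransSym.fn f) (fun i => (ts i).lift P) := by
  rw [← Term.mk_out (Term.lift P _), Term.lift, Term.out_unfold]
  simp only [Term.app, Term.out_mk]
  rfl

/-- The finite term `p_in(s₁, …, sₙ)` for an atom `p(s₁, …, sₙ)`. -/
noncomputable def inTerm (A : Atom D (FTerm F V)) : FTerm (transAlphabet P) V :=
  .app (F := transAlphabet P) (TransSym.pin A.pred) (fun i => (A.args i).lift P)

/-- The finite term `p_out(s₁, …, sₙ)` for an atom `p(s₁, …, sₙ)`. -/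
noncomputable def outTerm (A : Atom D (FTerm F V)) : FTerm (transAlphabet P) V :=
  .app (F := transAlphabet P) (TransSym.pout A.pred) (fun i => (A.args i).lift P)

/-- The term `u_{c,i}(t, X₁, …, Xₘ)`, where `X₁, …, Xₘ` are the variables of the head of `c` and of
the body atoms of `c` before the one with index `i` (which counts from `0`). -/
noncomputable def uTerm (c : {c // c ∈ P}) (i : Fin c.1.body.length)
    (t : FTerm (transAlphabet P) V) : FTerm (transAlphabet P) V :=
  .app (F := transAlphabet P) (TransSym.u c i)
    (Fin.cons (α := fun _ => FTerm (transAlphabet P) V) t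
      (fun j : Fin (c.1.varsUpTo i).length => .var ((c.1.varsUpTo i).get j)))

/-- The rules of the transformed system. -/
inductive TransRule : Rule (transAlphabet P) V → Prop
  | fact (c : {c // c ∈ P}) (h : c.1.body = []) :
      TransRule ⟨inTerm P c.1.head, outTerm P c.1.head⟩
  | first (c : {c // c ∈ P}) (h : 0 < c.1.body.length) :
      TransRule ⟨inTerm P c.1.head, uTerm P c ⟨0, h⟩ (inTerm P c.1.body[0])⟩
  | next (c : {c // c ∈ P}) (i : ℕ) (h : i + 1 < c.1.body.length) :
      TransRule ⟨uTerm P c ⟨i, by omega⟩ (outTerm P c.1.body[i]),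
        uTerm P c ⟨i + 1, h⟩ (inTerm P c.1.body[i + 1])⟩
  | last (c : {c // c ∈ P}) (i : ℕ) (h : i + 1 = c.1.body.length) :
      TransRule ⟨uTerm P c ⟨i, by omega⟩ (outTerm P c.1.body[i]), outTerm P c.1.head⟩

theorem finite_transRule : {r | TransRule P r}.Finite := by
  let g₁ : {c // c ∈ P} → Rule (transAlphabet P) V := fun c =>
    ⟨inTerm P c.1.head, outTerm P c.1.head⟩
  let g₂ : (Σ c : {c // c ∈ P}, Fin c.1.body.length) → Rule (transAlphabet P) V := fun c =>
    ⟨inTerm P c.1.1.head, uTerm P c.1 c.2 (inTerm P c.1.1.body[c.2])⟩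
  let g₃ : (Σ c : {c // c ∈ P}, Fin c.1.body.length × Fin c.1.body.length) →
      Rule (transAlphabet P) V := fun c =>
    ⟨uTerm P c.1 c.2.1 (outTerm P c.1.1.body[c.2.1]),
      uTerm P c.1 c.2.2 (inTerm P c.1.1.body[c.2.2])⟩
  let g₄ : (Σ c : {c // c ∈ P}, Fin c.1.body.length) → Rule (transAlphabet P) V := fun c =>
    ⟨uTerm P c.1 c.2 (outTerm P c.1.1.body[c.2]), outTerm P c.1.1.head⟩
  refine (((Set.finite_range g₁).union (Set.finite_range g₂)).union
    ((Set.finite_range g₃).union (Set.finite_range g₄))).subset ?_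
  rintro r (⟨c, h⟩ | ⟨c, h⟩ | ⟨c, i, h⟩ | ⟨c, i, h⟩)
  · exact Or.inl (Or.inl ⟨c, rfl⟩)
  · exact Or.inl (Or.inr ⟨⟨c, ⟨0, h⟩⟩, rfl⟩)
  · exact Or.inr (Or.inl ⟨⟨c, ⟨i, by omega⟩, ⟨i + 1, h⟩⟩, rfl⟩)
  · exact Or.inr (Or.inr ⟨⟨c, ⟨i, by omega⟩⟩, rfl⟩)

/-- The rewrite system that a logic program is transformed into. -/
noncomputable def transTRS : TRS (transAlphabet P) V where
  rules := {r | TransRule P r}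
  finite := finite_transRule P
  lhs_ne_var := by
    rintro r (⟨c, h⟩ | ⟨c, h⟩ | ⟨c, i, h⟩ | ⟨c, i, h⟩) X hX <;> cases hX

end Transformation

/-! ### Argument filters -/

/-- Argument filters over an alphabet: for every symbol, a set of argument positions. -/
abbrev ArgFilter (F : Alphabet.{u}) : Type u := (f : F.Sym) → Finset (Fin (F.arity f))

/-- The filtered alphabet: every symbol keeps only the selected arguments. -/
abbrev Alphabet.filtered (F : Alphabet.{u}) (π : ArgFilter F) : Alphabet.{u} where
  Sym := F.Sym
  arity f := (π f).card

/-- The filtered term, where `π(X) = X` for variables and `π(f(t₁, …, tₙ)) = f(π(t_{i₁}), …, π(t_{iₖ}))`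
if `π(f) = {i₁ < … < iₖ}`. -/
def Term.filter {F : Alphabet.{u}} {V : Type v} (π : ArgFilter F) (t : Term F V) :
    Term (F.filtered π) V :=
  Term.unfold
    (fun t : Term F V => match t.out with
      | .var X => Layer.var X
      | .app f ts => Layer.app (F := F.filtered π) f
          (fun i => ts ((π f).orderEmbOfFin rfl i)))
    t

theorem Term.filter_var {F : Alphabet.{u}} {V : Type v} (π : ArgFilter F) (X : V) :
    (Term.var X : Term F V).filter π = Term.var X := by
  rw [← Term.mk_out (Term.filter π _), Term.filter, Term.out_unfold]
  simp only [Term.var, Term.out_mk]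
  rfl

theorem Term.filter_app {F : Alphabet.{u}} {V : Type v} (π : ArgFilter F) (f : F.Sym)
    (ts : Fin (F.arity f) → Term F V) :
    (Term.app f ts).filter π =
      Term.app (F := F.filtered π) f
        (fun i => (ts ((π f).orderEmbOfFin rfl i)).filter π) := by
  rw [← Term.mk_out (Term.filter π _), Term.filter, Term.out_unfold]
  simp only [Term.app, Term.out_mk]
  rfl

/-- Argument filters over a signature of function symbols `F` and predicate symbols `D`. -/
structure SigFilter (F : Alphabet.{u}) (D : Alphabet.{v}) : Type (max u v) where
  fn : ArgFilter F
  pr : ArgFilter D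

/-- The filtered atom `π(p(t₁, …, tₙ)) = p(π(t_{i₁}), …, π(t_{iₖ}))` if `π(p) = {i₁ < … < iₖ}`. -/
def Atom.filter {F : Alphabet.{u}} {D : Alphabet.{v}} {V : Type w} (π : SigFilter F D)
    (A : Atom D (Term F V)) : Atom (D.filtered π.pr) (Term (F.filtered π.fn) V) where
  pred := A.pred
  args i := (A.args ((π.pr A.pred).orderEmbOfFin rfl i)).filter π.fn

/-- The extension of `π` to the transformed signature with `π(p_in) = π(p)`. The values for the
symbols `p_out` and `u_{c,i}`, which do not occur in the terms `p_in(t₁, …, tₙ)` over function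
symbols that are considered, play no role. -/
noncomputable def SigFilter.extend {F : Alphabet.{u}} {D : Alphabet.{v}} {V : Type w} (π : SigFilter F D)
    (P : Program F D V) : ArgFilter (transAlphabet P)
  | .fn f => π.fn f
  | .pin p => π.pr p
  | .pout _ => Finset.univ
  | .u _ _ => Finset.univ

/-- The terms `p_in(t₁, …, tₙ)` with possibly infinite terms `tᵢ` over the function symbols such that
`π(p_in(t₁, …, tₙ))` is a finite ground term. -/
def startTerms {F : Alphabet.{u}} {D : Alphabet.{v}} {V : Type w} (P : Program F D V)
    (π : SigFilter F D) : Set (Term (transAlphabet P) V) :=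
  {s | (∃ (p : D.Sym) (ts : Fin (D.arity p) → Term F V),
      s = Term.app (F := transAlphabet P) (TransSym.pin p) (fun i => (ts i).lift P)) ∧
    (s.filter (π.extend P)).IsFinite ∧ (s.filter (π.extend P)).IsGround}

end LP

/-!
The proof passes from SLD derivations to derivations by clause instances and then to rewriting.

*Limits.* Let `θ 0, θ 1, …` be the unifiers of an infinite derivation. Since terms may be infinite,
the infinite compositions `τ i = θ i θ (i + 1) …` exist as substitutions: a function symbol that
occurs at some stage is never changed later, and a position that holds a variable at every
stage is filled with a constant. They satisfy `τ i = θ i τ (i + 1)` (`Term.subst_limitSubst_succ`), so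
applying `τ i` to the `i`-th query turns the derivation into an infinite one in which the selected
atom *equals* the head of a clause instance and is replaced by the instantiated body
(`not_acc_instanceStep`).

*Locating the divergence.* If the atom `A` admits an infinite derivation by clause instances, then `A`
is the head of a clause instance in whose body some atom `B` again admits one, while all atoms before
`B` are provable (`exists_diverging_body_atom`).

*Rewriting.* For a provable atom, `p_in` rewrites to `p_out` with the same arguments
(`Provable.rewrites`). The variables of a rule that occur only on its right-hand side may be
instantiated by arbitrary constructor terms, so a single instance of the clause serves for all its
rules. Hence the `p_in`-term of a diverging atom rewrites in at least one step to a term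
that contains the `p_in`-term of another diverging atom, and so on forever. Finally,
`π(Q)` being finite and ground, it is not affected by instantiating `Q`, so the `p_in`-term of
`Q` instantiated by `τ 0` is one of the start terms.
-/

namespace LP

/-! ### Terms and substitutions -/

namespace Term

variable {F : Alphabet.{u}} {V : Type v}

theorem eq_var_or_eq_app (t : Term F V) : (∃ X, t = var X) ∨ ∃ f ts, t = app f ts := by
  rw [← mk_out t]
  cases t.out with
  | var X => exact Or.inl ⟨X, rfl⟩
  | app f ts => exact Or.inr ⟨f, ts, rfl⟩

theorem out_var (X : V) : (var X : Term F V).out = .var X := out_mk _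

theorem out_app (f : F.Sym) (ts : Fin (F.arity f) → Term F V) : (app f ts).out = .app f ts :=
  out_mk _

theorem var_ne_app {X : V} {f : F.Sym} {ts : Fin (F.arity f) → Term F V} : var X ≠ app f ts := by
  intro h
  have := congrArg out h
  rw [out_var, out_app] at this
  cases this

theorem app_inj {f g : F.Sym} {ts : Fin (F.arity f) → Term F V} {us : Fin (F.arity g) → Term F V}
    (h : app f ts = app g us) : f = g ∧ ts ≍ us := by
  have := congrArg out h
  rw [out_app, out_app] at this
  cases this
  exact ⟨rfl, HEq.rfl⟩

theorem isGround_app_iff {f : F.Sym} {ts : Fin (F.arity f) → Term F V} :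
    (app f ts).IsGround ↔ ∀ i, (ts i).IsGround := by
  simp only [IsGround, Set.eq_empty_iff_forall_notMem, vars, Set.mem_ofPred_eq]
  constructor
  · exact fun h i X hX => h X (.arg f ts i hX)
  · intro h X hX
    generalize hs : app f ts = s at hX
    cases hX with
    | refl => exact var_ne_app hs.symm
    | arg g us i hi =>
      obtain ⟨rfl, hu⟩ := app_inj hs
      cases hu
      exact h i X hi

theorem not_isGround_var (X : V) : ¬ (var X : Term F V).IsGround := fun h =>
  (Set.eq_empty_iff_forall_notMem.1 h X) .refl

/-! ### Infinite compositions of substitutions -/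

/-- A pair `(i, t)` stands for the term `t` to which `θ i, θ (i + 1), …` are yet to be applied.
This map applies `θ i`. -/
def advance (θ : ℕ → Subst F V) (x : ℕ × Term F V) : ℕ × Term F V := (x.1 + 1, x.2.subst (θ x.1))

theorem iterate_advance_app (θ : ℕ → Subst F V) (n i : ℕ) (f : F.Sym)
    (ts : Fin (F.arity f) → Term F V) :
    (advance θ)^[n] (i, app f ts) =
      (i + n, app f (fun j => ((advance θ)^[n] (i, ts j)).2)) := by
  induction n generalizing i ts with
  | zero => rfl
  | succ n ih =>
    simp only [Function.iterate_succ_apply, advance, subst_app]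
    rw [ih, Nat.add_right_comm, Nat.add_assoc]

theorem iterate_advance_fst (θ : ℕ → Subst F V) (n : ℕ) (x : ℕ × Term F V) :
    ((advance θ)^[n] x).1 = x.1 + n := by
  induction n generalizing x with
  | zero => rfl
  | succ n ih =>
    rw [Function.iterate_succ_apply, ih]
    simp only [advance]
    omega

/-- The state `x` has a function symbol at its root from stage `k` on. -/
def RootAt (θ : ℕ → Subst F V) (x : ℕ × Term F V) (k : ℕ) : Prop :=
  ∃ f ts, ((advance θ)^[k] x).2 = app f ts

open Classical in
/-- The root of the limit of `x` together with the states whose limits are its arguments. If the root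
is a variable at all stages, then it is replaced by the constant `a`. -/
noncomputable def limitLayer (θ : ℕ → Subst F V) (a : F.Sym) (ha : F.arity a = 0)
    (x : ℕ × Term F V) : Layer F V (ℕ × Term F V) :=
  if h : ∃ k, RootAt θ x k then
    .app h.choose_spec.choose fun j =>
      (((advance θ)^[h.choose] x).1, h.choose_spec.choose_spec.choose j)
  else .app a fun j => (Fin.cast ha j).elim0

/-- The limit of a state `(i, t)`, i.e. the result of applying `θ i, θ (i + 1), …` to `t`. -/
noncomputable def limit (θ : ℕ → Subst F V) (a : F.Sym) (ha : F.arity a = 0)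
    (x : ℕ × Term F V) : Term F V := unfold (limitLayer θ a ha) x

variable {θ : ℕ → Subst F V} {a : F.Sym} {ha : F.arity a = 0}

theorem exists_limit_out {x : ℕ × Term F V} (h : ∃ k, RootAt θ x k) :
    ∃ k f ts, (advance θ)^[k] x = (x.1 + k, app f ts) ∧
      (limit θ a ha x).out = .app f (fun j => limit θ a ha (x.1 + k, ts j)) := by
  refine ⟨h.choose, h.choose_spec.choose, h.choose_spec.choose_spec.choose,
    Prod.ext (iterate_advance_fst _ _ _) h.choose_spec.choose_spec.choose_spec, ?_⟩
  rw [limit, out_unfold, limitLayer, dif_pos h]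
  simp only [Layer.map, iterate_advance_fst]
  rfl

theorem limit_out_of_not {x : ℕ × Term F V} (h : ¬ ∃ k, RootAt θ x k) :
    (limit θ a ha x).out = .app a (fun j => (Fin.cast ha j).elim0) := by
  rw [limit, out_unfold, limitLayer, dif_neg h, Layer.map]
  congr 1
  funext j
  exact (Fin.cast ha j).elim0

theorem RootAt.mono {x : ℕ × Term F V} {k : ℕ} (h : RootAt θ x k) (n : ℕ) :
    RootAt θ x (n + k) := by
  obtain ⟨f, ts, h⟩ := h
  have hx : (advance θ)^[k] x = (((advance θ)^[k] x).1, app f ts) := Prod.ext rfl h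
  refine ⟨f, fun j => ((advance θ)^[n] (((advance θ)^[k] x).1, ts j)).2, ?_⟩
  rw [Function.iterate_add_apply, hx, iterate_advance_app]

theorem RootAt.of_iterate_eq {x y : ℕ × Term F V} {m n k : ℕ}
    (hxy : (advance θ)^[m] x = (advance θ)^[n] y) (h : RootAt θ x k) : RootAt θ y (k + n) := by
  obtain ⟨f, ts, h⟩ := h.mono m
  refine ⟨f, ts, ?_⟩
  rw [Function.iterate_add_apply, ← hxy, ← Function.iterate_add_apply, Nat.add_comm, h]

/-- States that become equal at some stage have the same limit. -/
theorem limit_eq_of_iterate_eq {x y : ℕ × Term F V} {m n : ℕ}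
    (h : (advance θ)^[m] x = (advance θ)^[n] y) : limit θ a ha x = limit θ a ha y := by
  refine eq_of_bisim (fun s t => ∃ x y m n, (advance θ)^[m] x = (advance θ)^[n] y ∧
    s = limit θ a ha x ∧ t = limit θ a ha y) ?_ _ _ ⟨x, y, m, n, h, rfl, rfl⟩
  rintro _ _ ⟨x, y, m, n, h, rfl, rfl⟩
  right
  by_cases hx : ∃ k, RootAt θ x k
  · have hy : ∃ k, RootAt θ y k := ⟨_, hx.choose_spec.of_iterate_eq h⟩
    obtain ⟨k, f, ts, hk, ho⟩ := exists_limit_out (a := a) (ha := ha) hx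
    obtain ⟨l, g, us, hl, ho'⟩ := exists_limit_out (a := a) (ha := ha) hy
    -- Both roots have appeared when `x` is advanced by `l + m + k` and `y` by `k + n + l` stages.
    have key : (advance θ)^[l + m] (x.1 + k, app f ts) =
        (advance θ)^[k + n] (y.1 + l, app g us) := by
      rw [← hk, ← hl, ← Function.iterate_add_apply, ← Function.iterate_add_apply,
        show l + m + k = (k + l) + m by omega, show k + n + l = (k + l) + n by omega,
        Function.iterate_add_apply, h, ← Function.iterate_add_apply]
    rw [iterate_advance_app, iterate_advance_app, Prod.mk.injEq] at key
    obtain ⟨h1, h2⟩ := key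
    obtain ⟨rfl, h3⟩ := app_inj h2
    refine ⟨f, _, _, ho, ho', fun j => ⟨_, _, l + m, k + n, ?_, rfl, rfl⟩⟩
    refine Prod.ext ?_ (congrFun (eq_of_heq h3) j)
    rw [iterate_advance_fst, iterate_advance_fst]
    exact h1
  · have hy : ¬ ∃ k, RootAt θ y k := fun ⟨k, hk⟩ => hx ⟨_, hk.of_iterate_eq h.symm⟩
    exact ⟨a, _, _, limit_out_of_not hx, limit_out_of_not hy, fun j => (Fin.cast ha j).elim0⟩

theorem limit_advance (x : ℕ × Term F V) : limit θ a ha (advance θ x) = limit θ a ha x :=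
  limit_eq_of_iterate_eq (m := 0) (n := 1) rfl

theorem limit_app (i : ℕ) (f : F.Sym) (ts : Fin (F.arity f) → Term F V) :
    (limit θ a ha (i, app f ts)).out = .app f (fun j => limit θ a ha (i, ts j)) := by
  obtain ⟨k, g, us, hk, ho⟩ :=
    exists_limit_out (θ := θ) (a := a) (ha := ha) (x := (i, app f ts)) ⟨0, f, ts, rfl⟩
  rw [iterate_advance_app, Prod.mk.injEq] at hk
  obtain ⟨rfl, h⟩ := app_inj hk.2
  rw [ho]
  congr 1
  funext j
  refine limit_eq_of_iterate_eq (m := 0) (n := k) (Prod.ext ?_ ?_)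
  · exact (iterate_advance_fst θ k (i, ts j)).symm
  · exact (congrFun (eq_of_heq h) j).symm

/-- The infinite composition `θ i θ (i + 1) …`. -/
noncomputable def limitSubst (θ : ℕ → Subst F V) (a : F.Sym) (ha : F.arity a = 0) (i : ℕ) :
    Subst F V := fun X => limit θ a ha (i, var X)

theorem subst_limitSubst (i : ℕ) (t : Term F V) :
    t.subst (limitSubst θ a ha i) = limit θ a ha (i, t) := by
  refine eq_of_bisim (fun s u => s = u ∨ ∃ t, s = t.subst (limitSubst θ a ha i) ∧
    u = limit θ a ha (i, t)) ?_ _ _ (Or.inr ⟨t, rfl, rfl⟩)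
  have hrefl : ∀ s : Term F V, (∃ X, s.out = .var X ∧ s.out = .var X) ∨
      ∃ f ss ts, s.out = .app f ss ∧ s.out = .app f ts ∧ ∀ j, ss j = ts j ∨
        ∃ t, ss j = t.subst (limitSubst θ a ha i) ∧ ts j = limit θ a ha (i, t) := by
    intro s
    cases h : s.out with
    | var X => exact Or.inl ⟨X, rfl, rfl⟩
    | app f ts => exact Or.inr ⟨f, ts, ts, rfl, rfl, fun j => Or.inl rfl⟩
  rintro s _ (rfl | ⟨t, rfl, rfl⟩)
  · exact hrefl s
  · obtain ⟨X, rfl⟩ | ⟨f, ts, rfl⟩ := t.eq_var_or_eq_app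
    · rw [subst_var]
      exact hrefl _
    · refine Or.inr ⟨f, _, _, ?_, limit_app i f ts, fun j => Or.inr ⟨ts j, rfl, rfl⟩⟩
      rw [subst_app, out_app]

theorem subst_limitSubst_succ (i : ℕ) (t : Term F V) :
    (t.subst (θ i)).subst (limitSubst θ a ha (i + 1)) = t.subst (limitSubst θ a ha i) := by
  rw [subst_limitSubst, subst_limitSubst]
  exact limit_advance (i, t)

end Term

theorem FTerm.toTerm_rename_subst {F : Alphabet.{u}} {V : Type v} (ρ : V → V) (σ : Subst F V)
    (s : FTerm F V) : (s.rename ρ).toTerm.subst σ = s.toTerm.subst (fun X => σ (ρ X)) := by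
  induction s with
  | var X => simp only [FTerm.rename, FTerm.toTerm, Term.subst_var]
  | app f ts ih => simp only [FTerm.rename, FTerm.toTerm, Term.subst_app, ih]

/-! ### Derivations by clause instances -/

section Instances

variable {F : Alphabet.{u}} {D : Alphabet.{v}} {V : Type w}

/-- The instance of a finite atom under a substitution by possibly infinite terms. -/
def Atom.inst (ρ : Subst F V) (A : Atom D (FTerm F V)) : Atom D (Term F V) := A.toTerm.subst ρ

theorem Atom.inst_rename (ρ : V → V) (σ : Subst F V) (A : Atom D (FTerm F V)) :
    (A.map (FTerm.rename ρ)).inst σ = A.inst (fun X => σ (ρ X)) := by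
  simp only [Atom.inst, Atom.subst, Atom.toTerm, Atom.map, FTerm.toTerm_rename_subst]

/-- One resolution step in which the selected atom is already equal to the head of an instance
of a clause. -/
inductive InstanceStep (P : Program F D V) : Query F D V → Query F D V → Prop
  | intro (c : Clause F D V) (hc : c ∈ P) (ρ : Subst F V) (As : Query F D V) :
      InstanceStep P (c.head.inst ρ :: As) (c.body.map (Atom.inst ρ) ++ As)

/-- Atoms that have a proof tree whose nodes are instances of clauses of `P`. -/
inductive Provable (P : Program F D V) : Atom D (Term F V) → Prop
  | intro (c : Clause F D V) (hc : c ∈ P) (ρ : Subst F V)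
      (h : ∀ B ∈ c.body, Provable P (B.inst ρ)) : Provable P (c.head.inst ρ)

/-- The atom `A` has an infinite derivation by clause instances. -/
def Diverges (P : Program F D V) (A : Atom D (Term F V)) : Prop :=
  ¬ Acc (flip (InstanceStep P)) [A]

/-- Every infinite derivation becomes an infinite derivation by clause instances when its
queries are instantiated by the infinite compositions of the remaining unifiers. -/
theorem not_acc_instanceStep {P : Program F D V} {Q : ℕ → Query F D V} {c : ℕ → Clause F D V}
    {θ : ℕ → Subst F V} (h : IsInfiniteDerivation P Q c θ) (a : F.Sym) (ha : F.arity a = 0) :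
    ¬ Acc (flip (InstanceStep P)) ((Q 0).map (Atom.subst (Term.limitSubst θ a ha 0))) := by
  rw [not_acc_iff_exists_descending_chain]
  refine ⟨fun i => (Q i).map (Atom.subst (Term.limitSubst θ a ha i)), rfl, fun i => ?_⟩
  obtain ⟨A, As, hQ, ⟨hu, -⟩, hQ'⟩ := h.resolvent i
  obtain ⟨c₀, hc₀, ρ, hρ⟩ := h.variant i
  have hsucc : ∀ B : Atom D (Term F V), (B.subst (θ i)).subst (Term.limitSubst θ a ha (i + 1)) =
      B.subst (Term.limitSubst θ a ha i) := fun B => by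
    simp only [Atom.subst, Atom.map, Term.subst_limitSubst_succ]
  have hA : A.subst (Term.limitSubst θ a ha i) =
      c₀.head.inst (fun X => Term.limitSubst θ a ha i (ρ X)) := by
    rw [← hsucc, hu, hsucc, hρ]
    exact Atom.inst_rename ρ _ c₀.head
  have hB : ((c i).body.map Atom.toTerm).map (Atom.subst (Term.limitSubst θ a ha i)) =
      c₀.body.map (Atom.inst fun X => Term.limitSubst θ a ha i (ρ X)) := by
    rw [hρ, List.map_map, Clause.rename, List.map_map]
    exact List.map_congr_left fun B _ => Atom.inst_rename ρ _ B
  have key := InstanceStep.intro c₀ hc₀ (fun X => Term.limitSubst θ a ha i (ρ X))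
    (As.map (Atom.subst (Term.limitSubst θ a ha i)))
  rw [← hA, ← hB, ← List.map_cons, ← List.map_append, ← hQ] at key
  change InstanceStep P ((Q i).map _) ((Q (i + 1)).map _)
  rw [hQ', List.map_map]
  convert key using 2
  exact funext hsucc

/-- A query `L, M` terminates if `L` does and if `M` does in case that `L` can be resolved
completely. -/
theorem acc_append {P : Program F D V} {L M : Query F D V} (hL : Acc (flip (InstanceStep P)) L)
    (hM : (∀ A ∈ L, Provable P A) → Acc (flip (InstanceStep P)) M) :
    Acc (flip (InstanceStep P)) (L ++ M) := by
  induction hL with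
  | intro L _ ih =>
    cases L with
    | nil => exact hM (by simp)
    | cons A L =>
      refine Acc.intro _ fun R hR => ?_
      change InstanceStep P (A :: (L ++ M)) R at hR
      cases hR with
      | intro c hc ρ =>
        rw [← List.append_assoc]
        refine ih _ (InstanceStep.intro c hc ρ L) fun hp => hM fun B hB => ?_
        rcases List.mem_cons.1 hB with rfl | hB
        · exact .intro c hc ρ fun B hB =>
            hp _ (List.mem_append_left _ (List.mem_map_of_mem hB))
        · exact hp B (List.mem_append_right _ hB)

theorem exists_diverging_atom {P : Program F D V} {L : Query F D V}
    (hL : ¬ Acc (flip (InstanceStep P)) L) :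
    ∃ (j : ℕ) (hj : j < L.length), Diverges P L[j] ∧
      ∀ (i : ℕ) (hi : i < j), Provable P (L[i]'(hi.trans hj)) := by
  induction L with
  | nil => exact absurd (Acc.intro _ fun R hR => by cases hR) hL
  | cons A L ih =>
    by_cases hA : Diverges P A
    · exact ⟨0, by simp, hA, fun i hi => absurd hi (Nat.not_lt_zero i)⟩
    · have hL' : Provable P A ∧ ¬ Acc (flip (InstanceStep P)) L := by
        by_contra hcon
        refine hL (acc_append (L := [A]) (not_not.1 hA) fun hp => ?_)
        by_contra hn
        exact hcon ⟨hp A (by simp), hn⟩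
      obtain ⟨j, hj, hd, hp⟩ := ih hL'.2
      refine ⟨j + 1, by simpa using hj, by simpa using hd, fun i hi => ?_⟩
      cases i with
      | zero => exact hL'.1
      | succ i => simpa using hp i (by omega)

theorem exists_diverging_body_atom {P : Program F D V} {A : Atom D (Term F V)}
    (hA : Diverges P A) :
    ∃ (c : Clause F D V) (_ : c ∈ P) (ρ : Subst F V) (j : ℕ) (hj : j < c.body.length),
      A = c.head.inst ρ ∧ Diverges P (c.body[j].inst ρ) ∧
        ∀ (i : ℕ) (hi : i < j), Provable P ((c.body[i]'(hi.trans hj)).inst ρ) := by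
  obtain ⟨R, hR, hstep⟩ := exists_not_acc_lt_of_not_acc hA
  change InstanceStep P [A] R at hstep
  cases hstep with
  | intro c hc ρ =>
    rw [List.append_nil] at hR
    obtain ⟨j, hj, hd, hp⟩ := exists_diverging_atom hR
    exact ⟨c, hc, ρ, j, by simpa using hj, rfl, by simpa using hd,
      fun i hi => by simpa using hp i hi⟩

end Instances

/-! ### Simulating derivations by rewriting -/

theorem TRS.transGen_step_arg {G : Alphabet.{u}} {V : Type v} {R : TRS G V} {f : G.Sym}
    {ts : Fin (G.arity f) → Term G V} {i : Fin (G.arity f)} {s t : Term G V} (hs : ts i = s)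
    (h : Relation.TransGen R.Step s t) :
    Relation.TransGen R.Step (Term.app f ts) (Term.app f (Function.update ts i t)) := by
  subst hs
  induction h with
  | single h => exact .single (.arg f ts i _ h)
  | @tail t t' _ h ih =>
    have := TRS.Step.arg (R := R) f (Function.update ts i t) i t' (by simpa using h)
    rw [Function.update_idem] at this
    exact ih.tail this

section Simulation

variable {F : Alphabet.{u}} {D : Alphabet.{v}} {V : Type w} (P : Program F D V)

/-- The substitution `ρ`, regarded over the transformed signature. -/
noncomputable def liftSubst (ρ : Subst F V) : Subst (transAlphabet P) V := fun X => (ρ X).lift P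

theorem lift_toTerm_subst (ρ : Subst F V) (s : FTerm F V) :
    (s.lift P).toTerm.subst (liftSubst P ρ) = (s.toTerm.subst ρ).lift P := by
  induction s with
  | var X => simp only [FTerm.lift, FTerm.toTerm, Term.subst_var, liftSubst]
  | app f ts ih => simp only [FTerm.lift, FTerm.toTerm, Term.subst_app, Term.lift_app, ih]

theorem exists_eq_lift_of_subterm {s : Term (transAlphabet P) V} {t : Term F V}
    (h : Term.Subterm s (t.lift P)) : ∃ t' : Term F V, s = t'.lift P := by
  generalize hu : t.lift P = u at h
  induction h generalizing t with
  | refl => exact ⟨t, hu.symm⟩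
  | arg f ts i _ ih =>
    obtain ⟨X, rfl⟩ | ⟨g, us, rfl⟩ := t.eq_var_or_eq_app
    · rw [Term.lift_var] at hu
      exact absurd hu Term.var_ne_app
    · rw [Term.lift_app] at hu
      obtain ⟨rfl, hu⟩ := Term.app_inj hu
      cases hu
      exact ih rfl

theorem syms_liftSubst_subset (ρ : Subst F V) (X : V) :
    (liftSubst P ρ X).syms ⊆ (transTRS P).constructors := by
  rintro f ⟨ts, hf⟩ ⟨r, hr, us, hus⟩
  obtain ⟨t, ht⟩ := exists_eq_lift_of_subterm P hf
  obtain ⟨Y, rfl⟩ | ⟨g, vs, rfl⟩ := t.eq_var_or_eq_app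
  · rw [Term.lift_var] at ht
    exact Term.var_ne_app ht.symm
  · rw [Term.lift_app] at ht
    obtain ⟨rfl, -⟩ := Term.app_inj ht
    -- No left-hand side of a transformed rule has a symbol `f` of the program at its root.
    rcases hr with ⟨c, h⟩ | ⟨c, h⟩ | ⟨c, i, h⟩ | ⟨c, i, h⟩ <;> cases hus

/-- The term `p_in(t₁, …, tₙ)` for an atom `p(t₁, …, tₙ)` with possibly infinite arguments. -/
noncomputable def callTerm (A : Atom D (Term F V)) : Term (transAlphabet P) V :=
  .app (F := transAlphabet P) (TransSym.pin A.pred) (fun i => (A.args i).lift P)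

/-- The term `p_out(t₁, …, tₙ)` for an atom `p(t₁, …, tₙ)` with possibly infinite arguments. -/
noncomputable def answerTerm (A : Atom D (Term F V)) : Term (transAlphabet P) V :=
  .app (F := transAlphabet P) (TransSym.pout A.pred) (fun i => (A.args i).lift P)

/-- The instance under `ρ` of the term `u_{c,i}(t, X₁, …, Xₘ)`, where `t` is not instantiated. -/
noncomputable def frameTerm (c : {c // c ∈ P}) (ρ : Subst F V) (i : Fin c.1.body.length)
    (t : Term (transAlphabet P) V) : Term (transAlphabet P) V :=
  .app (F := transAlphabet P) (TransSym.u c i)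
    (Fin.cons (α := fun _ => Term (transAlphabet P) V) t
      (fun j : Fin (c.1.varsUpTo i).length => liftSubst P ρ ((c.1.varsUpTo i).get j)))

theorem toTerm_inTerm_subst (ρ : Subst F V) (A : Atom D (FTerm F V)) :
    (inTerm P A).toTerm.subst (liftSubst P ρ) = callTerm P (A.inst ρ) := by
  simp only [inTerm, FTerm.toTerm, Term.subst_app, lift_toTerm_subst]
  rfl

theorem toTerm_outTerm_subst (ρ : Subst F V) (A : Atom D (FTerm F V)) :
    (outTerm P A).toTerm.subst (liftSubst P ρ) = answerTerm P (A.inst ρ) := by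
  simp only [outTerm, FTerm.toTerm, Term.subst_app, lift_toTerm_subst]
  rfl

theorem toTerm_uTerm_subst (c : {c // c ∈ P}) (ρ : Subst F V) (i : Fin c.1.body.length)
    (t : FTerm (transAlphabet P) V) :
    (uTerm P c i t).toTerm.subst (liftSubst P ρ) =
      frameTerm P c ρ i (t.toTerm.subst (liftSubst P ρ)) := by
  simp only [uTerm, FTerm.toTerm, Term.subst_app, frameTerm]
  congr 1
  funext j
  refine Fin.cases ?_ (fun j => ?_) j
  · rfl
  · exact Term.subst_var _ _

variable {P}

theorem step_of_transRule {r : Rule (transAlphabet P) V} (hr : TransRule P r) (ρ : Subst F V) :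
    (transTRS P).Step (r.lhs.toTerm.subst (liftSubst P ρ))
      (r.rhs.toTerm.subst (liftSubst P ρ)) :=
  .root r _ hr (syms_liftSubst_subset P ρ)

theorem transGen_step_frameTerm (c : {c // c ∈ P}) (ρ : Subst F V) (i : Fin c.1.body.length)
    {s t : Term (transAlphabet P) V} (h : Relation.TransGen (transTRS P).Step s t) :
    Relation.TransGen (transTRS P).Step (frameTerm P c ρ i s) (frameTerm P c ρ i t) := by
  have key := TRS.transGen_step_arg (G := transAlphabet P) (R := transTRS P) (s := s) (f := (TransSym.u c i : (transAlphabet P).Sym))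
    (ts := Fin.cons (α := fun _ => Term (transAlphabet P) V) s
      (fun j : Fin (c.1.varsUpTo i).length => liftSubst P ρ ((c.1.varsUpTo i).get j)))
    (i := (0 : Fin ((c.1.varsUpTo i).length + 1))) rfl h
  have hu := Fin.update_cons_zero (α := fun _ => Term (transAlphabet P) V) s
    (fun j : Fin (c.1.varsUpTo i).length => liftSubst P ρ ((c.1.varsUpTo i).get j)) t
  exact (congrArg (fun us => Relation.TransGen (transTRS P).Step (frameTerm P c ρ i s)
    (Term.app (F := transAlphabet P) (TransSym.u c i) us)) hu).mp key

/-- If the calls of the body atoms before index `j` can be evaluated, then the call of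
the head reaches the call of the body atom with index `j`. -/
theorem transGen_step_body (c : {c // c ∈ P}) (ρ : Subst F V) (j : ℕ) (hj : j < c.1.body.length)
    (h : ∀ (i : ℕ) (hi : i < j), Relation.TransGen (transTRS P).Step
      (callTerm P ((c.1.body[i]'(hi.trans hj)).inst ρ))
      (answerTerm P ((c.1.body[i]'(hi.trans hj)).inst ρ))) :
    Relation.TransGen (transTRS P).Step (callTerm P (c.1.head.inst ρ))
      (frameTerm P c ρ ⟨j, hj⟩ (callTerm P (c.1.body[j].inst ρ))) := by
  induction j with
  | zero =>
    have := step_of_transRule (TransRule.first c hj) ρ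
    rw [toTerm_uTerm_subst, toTerm_inTerm_subst, toTerm_inTerm_subst] at this
    exact .single this
  | succ j ih =>
    have hstep := step_of_transRule (TransRule.next c j hj) ρ
    rw [toTerm_uTerm_subst, toTerm_uTerm_subst, toTerm_inTerm_subst, toTerm_outTerm_subst] at hstep
    exact ((ih (by omega) fun i hi => h i (by omega)).trans
      (transGen_step_frameTerm c ρ ⟨j, by omega⟩ (h j (by omega)))).tail hstep

theorem Provable.rewrites {A : Atom D (Term F V)} (hA : Provable P A) :
    Relation.TransGen (transTRS P).Step (callTerm P A) (answerTerm P A) := by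
  induction hA with
  | intro c hc ρ _ ih =>
    rcases Nat.eq_zero_or_pos c.body.length with h0 | hpos
    · have hstep := step_of_transRule (TransRule.fact ⟨c, hc⟩ (List.length_eq_zero_iff.1 h0)) ρ
      rw [toTerm_inTerm_subst, toTerm_outTerm_subst] at hstep
      exact .single hstep
    · obtain ⟨k, hk⟩ : ∃ k, k + 1 = c.body.length := ⟨c.body.length - 1, by omega⟩
      have hstep := step_of_transRule (TransRule.last ⟨c, hc⟩ k hk) ρ
      rw [toTerm_uTerm_subst, toTerm_outTerm_subst, toTerm_outTerm_subst] at hstep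
      exact ((transGen_step_body ⟨c, hc⟩ ρ k (by simp only; omega)
        fun i hi => ih _ (List.getElem_mem _)).trans
        (transGen_step_frameTerm ⟨c, hc⟩ ρ ⟨k, by simp only; omega⟩
          (ih _ (List.getElem_mem _)))).tail hstep

/-- Terms that contain the call of a diverging atom. -/
inductive HasDivergingCall (P : Program F D V) : Term (transAlphabet P) V → Prop
  | call (A : Atom D (Term F V)) (hA : Diverges P A) : HasDivergingCall P (callTerm P A)
  | arg (f : (transAlphabet P).Sym) (ts : Fin ((transAlphabet P).arity f) → Term (transAlphabet P) V)
      (i : Fin ((transAlphabet P).arity f)) (h : HasDivergingCall P (ts i)) :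
      HasDivergingCall P (Term.app f ts)

theorem HasDivergingCall.exists_transGen {t : Term (transAlphabet P) V}
    (h : HasDivergingCall P t) :
    ∃ t', Relation.TransGen (transTRS P).Step t t' ∧ HasDivergingCall P t' := by
  induction h with
  | call A hA =>
    obtain ⟨c, hc, ρ, j, hj, rfl, hd, hp⟩ := exists_diverging_body_atom hA
    refine ⟨_, transGen_step_body ⟨c, hc⟩ ρ j hj fun i hi => (hp i hi).rewrites, ?_⟩
    exact .arg (P := P) (TransSym.u ⟨c, hc⟩ ⟨j, hj⟩) _
      (0 : Fin ((c.varsUpTo j).length + 1)) (.call _ hd)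
  | arg f ts i _ ih =>
    obtain ⟨t', ht, hd⟩ := ih
    exact ⟨_, TRS.transGen_step_arg rfl ht, .arg f _ i (by simpa using hd)⟩

theorem HasDivergingCall.not_terminating {t : Term (transAlphabet P) V}
    (h : HasDivergingCall P t) : ¬ (transTRS P).Terminating t := by
  intro ht
  have hacc : Acc (flip (transTRS P).Step) t := by
    by_contra hn
    exact ht (not_acc_iff_exists_descending_chain.1 hn)
  have hacc' := hacc.transGen
  clear ht hacc
  induction hacc' with
  | intro t _ ih =>
    obtain ⟨t', hs, hd⟩ := h.exists_transGen
    exact ih t' (Relation.transGen_swap.2 hs) hd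

end Simulation

/-! ### Start terms -/

section Filter

variable {F : Alphabet.{u}} {D : Alphabet.{v}} {V : Type w}

/-- Instantiating a term whose filtered version is finite and ground keeps the filtered version
finite and ground: the instantiated variables are all filtered away. -/
theorem filter_lift_subst_finite_ground (P : Program F D V) (π : SigFilter F D) (τ : Subst F V)
    {t : Term F V} (hf : (t.filter π.fn).IsFinite) (hg : (t.filter π.fn).IsGround) :
    (((t.subst τ).lift P).filter (π.extend P)).IsFinite ∧
      (((t.subst τ).lift P).filter (π.extend P)).IsGround := by
  generalize hs : t.filter π.fn = s at hf hg
  induction hf generalizing t with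
  | var X => exact absurd hg (Term.not_isGround_var X)
  | app f ts _ ih =>
    obtain ⟨X, rfl⟩ | ⟨g, us, rfl⟩ := t.eq_var_or_eq_app
    · rw [Term.filter_var] at hs
      exact absurd hs Term.var_ne_app
    · rw [Term.filter_app] at hs
      obtain ⟨rfl, h⟩ := Term.app_inj hs
      cases h
      rw [Term.subst_app, Term.lift_app, Term.filter_app]
      rw [Term.isGround_app_iff] at hg
      have key := fun i => ih i rfl (hg i)
      exact ⟨.app _ _ fun i => (key i).1, Term.isGround_app_iff.2 fun i => (key i).2⟩

theorem callTerm_subst_mem_startTerms (P : Program F D V) (π : SigFilter F D) (τ : Subst F V)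
    {Q : Atom D (Term F V)} (hf : (Q.filter π).IsFinite) (hg : (Q.filter π).IsGround) :
    callTerm P (Q.subst τ) ∈ startTerms P π := by
  have hg' : ∀ i, ((Q.filter π).args i).IsGround := fun i =>
    Set.eq_empty_iff_forall_notMem.2 fun X hX => Set.eq_empty_iff_forall_notMem.1 hg X ⟨i, hX⟩
  have key := fun i => filter_lift_subst_finite_ground P π τ (hf i) (hg' i)
  refine ⟨⟨Q.pred, (Q.subst τ).args, rfl⟩, ?_⟩
  rw [callTerm, Term.filter_app]
  exact ⟨.app _ _ fun i => (key i).1, Term.isGround_app_iff.2 fun i => (key i).2⟩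

end Filter

end LP

theorem mainTheorem1 {F : LP.Alphabet.{u}} {D : LP.Alphabet.{v}} {V : Type w}
    [Finite F.Sym] [Finite D.Sym] [Infinite V] (hconst : ∃ f : F.Sym, F.arity f = 0)
    (P : LP.Program F D V) (π : LP.SigFilter F D)
    (hterm : ∀ s ∈ LP.startTerms P π, (LP.transTRS P).Terminating s) :
    ∀ Q : LP.Atom D (LP.Term F V), Q.IsRational →
      (Q.filter π).IsFinite → (Q.filter π).IsGround →
      LP.Query.Terminates P [Q] := by
  rintro Q - hf hg ⟨Qs, c, θ, h0, hder⟩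
  obtain ⟨a, ha⟩ := hconst
  have hdiv := LP.not_acc_instanceStep hder a ha
  rw [h0] at hdiv
  exact (LP.HasDivergingCall.call _ hdiv).not_terminating
    (hterm _ (LP.callTerm_subst_mem_startTerms P π _ hf hg))
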